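/- Let $d\ge 1$ be an integer and $\theta,\varphi,\chi\in\mathbb R$. On the logical qubit with basis $|0\rangle,|1\rangle$ put $Z=\mathrm{diag}(1,-1)$, $$F(\theta,\varphi,\chi)=\begin{pmatrix} e^{-i\varphi}\cos\theta & -i e^{i\chi}\sin\theta\\ -i e^{-i\chi}\sin\theta & e^{i\varphi}\cos\theta\end{pmatrix},\qquad \mathcal U_d(\omega)=\bigl(e^{i\omega Z}F(\theta,\varphi,\chi)\bigr)^d ,$$ and let $p_X(\omega)=|\langle 0|\mathcal U_d(\omega)|{+}\rangle|^2$ and $p_Y(\omega)=|\langle 0|\mathcal U_d(\omega)|\mathrm{i}\rangle|^2$, where $|{+}\rangle=\tfrac1{\sqrt2}(|0\rangle+|1\rangle)$ and $|\mathrm{i}\rangle=\tfrac1{\sqrt2}(|0\rangle+i|1\rangle)$. Let $\mathfrak h(\omega)=p_X(\omega)-\tfrac12+i\,(p_Y(\omega)-\tfrac12)$ be the reconstructed function, define $\tilde{\mathfrak h}$ by $\mathfrak h(\omega)=i e^{-i(\chi+\varphi)}\,\tilde{\mathfrak h}(\omega-\varphi,\theta)$, let $$\tilde c_k(\theta)=\frac1\pi\int_0^\pi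 e^{-2ik\omega}\,\tilde{\mathfrak h}(\omega,\theta)\,d\omega$$ be its Fourier coefficients and, for $\sin\theta\ne0$, let $\hat{\mathfrak h}(\omega,\cos\theta)=\tilde{\mathfrak h}(\omega,\theta)/(\sin\theta\, e^{-i\omega})$ be the normalized reconstructed function. Define the trigonometric polynomial, of first order in $1-\cos\theta$, $$\hat{\mathfrak h}^\star(\omega,\cos\theta)=\sum_{k=-d+1}^{d-1}\hat c_k^\star(\theta)\,e^{i(2k+1)\omega},$$ $$\hat c^\star_k(\theta)=\begin{cases}1-\tfrac12\bigl(3d^2-k^2-(k+1)^2-(d-(2k+1))^2\bigr)(1-\cos\theta), & 0\le k\le d-1,\\[2pt] -\tfrac12\bigl(d^2+(d+2k+1)^2-k^2-(k+1)^2\bigr)(1-\cos\theta), & -d+1\le k\le -1.\end{cases}$$ Then, if $\sin\theta\neq 0$, $$\max_{\omega\in[0,\pi]}\bigl|\hat{\mathfrak h}(\omega,\cos\theta)-\hat{\mathfrak h}^\star(\omega,\cos\theta)\bigr|\le 2d^5\theta^4,$$ and, for every $\theta\in\mathbb R$ and every integer $k$ with $-d+1\le k\le d-1$, $$\bigl|\tilde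 c_k(\theta)-\sin\theta\,\hat c_k^\star(\theta)\bigr|\le 2\,(d|\theta|)^5 .$$ -/

import Mathlib

/-- The logical `Z`-rotation `e^{iωZ}`, with `Z = diag(1, -1)`. -/
noncomputable def zRotation (ω : ℝ) : Matrix (Fin 2) (Fin 2) ℂ :=
  !![Complex.exp (Complex.I * ω), 0; 0, Complex.exp (-(Complex.I * ω))]

/-- The FsimGate on the single-excitation subspace, in the logical basis `|0⟩ = |01⟩`, `|1⟩ = |10⟩`:
swap angle `θ`, single-qubit phase `φ`, phase `χ`. -/
noncomputable def fsimGate (θ φ χ : ℝ) : Matrix (Fin 2) (Fin 2) ℂ :=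
  !![Complex.exp (-(Complex.I * φ)) * (Real.cos θ : ℂ),
      -Complex.I * Complex.exp (Complex.I * χ) * (Real.sin θ : ℂ);
    -Complex.I * Complex.exp (-(Complex.I * χ)) * (Real.sin θ : ℂ),
      Complex.exp (Complex.I * φ) * (Real.cos θ : ℂ)]

/-- The periodic circuit: `d` repetitions of the FsimGate followed by the tunable `Z`-rotation,
as a matrix in the logical basis. -/
noncomputable def qspcCircuit (d : ℕ) (ω θ φ χ : ℝ) : Matrix (Fin 2) (Fin 2) ℂ :=
  (zRotation ω * fsimGate θ φ χ) ^ d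

/-- The Bell state `(|0⟩ + |1⟩) / √2` in the logical basis. -/
noncomputable def bellPlus : Fin 2 → ℂ := ![1 / (Real.sqrt 2 : ℂ), 1 / (Real.sqrt 2 : ℂ)]

/-- The Bell state `(|0⟩ + i|1⟩) / √2` in the logical basis. -/
noncomputable def bellI : Fin 2 → ℂ := ![1 / (Real.sqrt 2 : ℂ), Complex.I / (Real.sqrt 2 : ℂ)]

/-- Probability `|⟨0| A |ψ⟩|²` of finding the logical state `|0⟩` after applying `A` to `|ψ⟩`. -/
noncomputable def transitionProb (A : Matrix (Fin 2) (Fin 2) ℂ) (ψ : Fin 2 → ℂ) : ℝ :=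
  ‖A.mulVec ψ 0‖ ^ 2

noncomputable def probX (d : ℕ) (ω θ φ χ : ℝ) : ℝ :=
  transitionProb (qspcCircuit d ω θ φ χ) bellPlus

noncomputable def probY (d : ℕ) (ω θ φ χ : ℝ) : ℝ :=
  transitionProb (qspcCircuit d ω θ φ χ) bellI

/-- The reconstructed function `h(ω; θ, φ, χ) = (p_X - 1/2) + i (p_Y - 1/2)`. -/
noncomputable def reconstructed (d : ℕ) (ω θ φ χ : ℝ) : ℂ :=
  ((probX d ω θ φ χ - 1 / 2 : ℝ) : ℂ) + Complex.I * ((probY d ω θ φ χ - 1 / 2 : ℝ) : ℂ)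

/-- The phase-free reconstructed function, determined by
`h(ω; θ, φ, χ) = i e^{-i(χ+φ)} hTilde(ω - φ)`. -/
noncomputable def hTilde (d : ℕ) (ω θ φ χ : ℝ) : ℂ :=
  reconstructed d (ω + φ) θ φ χ / (Complex.I * Complex.exp (-(Complex.I * (χ + φ))))

/-- The `k`-th Fourier coefficient of the `π`-periodic function `ω ↦ hTilde(ω)`, with respect to
`e^{2ikω}`. -/
noncomputable def cTilde (d : ℕ) (k : ℤ) (θ φ χ : ℝ) : ℂ :=
  (1 / (Real.pi : ℂ)) *
    ∫ ω in (0 : ℝ)..Real.pi, Complex.exp (-(2 * Complex.I * k * ω)) * hTilde d ω θ φ χ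

/-- The normalized reconstructed function `hTilde / (sin θ · e^{-iω})`; meaningful for
`sin θ ≠ 0`. -/
noncomputable def hHat (d : ℕ) (ω θ φ χ : ℝ) : ℂ :=
  hTilde d ω θ φ χ / ((Real.sin θ : ℂ) * Complex.exp (-(Complex.I * ω)))

/-- The coefficients of the first-order approximation. -/
noncomputable def cStar (d : ℕ) (k : ℤ) (θ : ℝ) : ℝ :=
  if 0 ≤ k then
    1 - 1 / 2 * (3 * (d : ℝ) ^ 2 - (k : ℝ) ^ 2 - ((k : ℝ) + 1) ^ 2
      - ((d : ℝ) - (2 * (k : ℝ) + 1)) ^ 2) * (1 - Real.cos θ)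
  else
    -(1 / 2) * ((d : ℝ) ^ 2 + ((d : ℝ) + 2 * (k : ℝ) + 1) ^ 2 - (k : ℝ) ^ 2
      - ((k : ℝ) + 1) ^ 2) * (1 - Real.cos θ)

/-- The first-order approximation, a trigonometric polynomial in `ω`. -/
noncomputable def hStar (d : ℕ) (ω θ : ℝ) : ℂ :=
  ∑ k ∈ Finset.Icc (-(d : ℤ) + 1) ((d : ℤ) - 1),
    (cStar d k θ : ℂ) * Complex.exp (Complex.I * (2 * k + 1) * ω)

/-!
With `x = cos θ * cos ω`, the single-step matrix of the circuit, for the rotation angle `ω + φ`,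
lies in `SU(2)` and has trace `2 * x`, so its powers are given by Chebyshev polynomials in `x`
(`pow_succ_eq_chebyshev_U`). If `(P, Q)` is the first row of the `d`-th power,
the two transition probabilities reconstruct `P * conj Q`
(`interference_eq_mul_conj`), and therefore (`hTilde_eq`)
`hTilde = sin θ * e^{-iω} * f (cos θ)`, where
`f t = U_{d-1}(t cos ω) * (T_d(t cos ω) + i t sin ω U_{d-1}(t cos ω))` is the polynomial `profile`.

The approximation `hStar` is exactly the first-order Taylor polynomial of `f` at `t = 1`
(`taylor_profile_eq_hStar`): for `sin ω ≠ 0` both are rational functions of `e^{iω}` and `e^{idω}`,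
the sums in `hStar` being quadratic-geometric, and the zeros of `sin ω` follow by continuity.

It remains to bound `f''` by `16 d^5` on `[-1, 1]` (`norm_profileDerivTwo_le`), since
`1 - cos θ ≤ θ ^ 2 / 2` then gives the error `16 d^5 / 2 * (θ ^ 2 / 2) ^ 2 = 2 d^5 θ^4`. The bounds
`|U^{(j)}| ≤ d^{2j+1}` alone would give order `d^6`; the power is saved because each
`sin ω`, which is at most `√(1 - x²)`, comes with a factor `U^{(j)}`, and
`√(1 - x²) |U^{(j)}| ≤ d^{2j}`. All these bounds follow by induction from the Pell equation and
`U_{n+1} = x U_n + T_{n+1}`.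

The bound on Fourier coefficients is the integral of the pointwise one, multiplied by
`|sin θ| ≤ |θ|`, as `sin θ * cStar` are the Fourier coefficients of `sin θ * e^{-iω} * hStar`
(`fourierCoeff_hStar`).
-/

/-! ### Bounds on Chebyshev polynomials of the second kind and their derivatives -/

open Polynomial.Chebyshev in
/-- The Pell equation of the Chebyshev polynomials, that is `cos² + sin² = 1`. -/
theorem chebyshev_pell (n : ℕ) (x : ℝ) :
    ((T ℝ (n + 1 : ℤ)).eval x) ^ 2 + (1 - x ^ 2) * ((U ℝ n).eval x) ^ 2 = 1 := by
  induction n with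
  | zero => simp
  | succ n ih =>
    have hU := congrArg (Polynomial.eval x) (U_eq_X_mul_U_add_T ℝ n)
    have hT := congrArg (Polynomial.eval x) (T_eq_X_mul_T_sub_pol_U ℝ n)
    simp only [Polynomial.eval_add, Polynomial.eval_sub, Polynomial.eval_mul, Polynomial.eval_pow,
      Polynomial.eval_X, Polynomial.eval_one] at hU hT
    push_cast
    rw [show (n : ℤ) + 1 + 1 = n + 2 by ring, hU, hT]
    linear_combination ih

open Polynomial.Chebyshev in
theorem abs_chebyshev_T_le_one (n : ℕ) {x : ℝ} (hx : x ^ 2 ≤ 1) :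
    |(T ℝ (n + 1 : ℤ)).eval x| ≤ 1 := by
  have h := chebyshev_pell n x
  rw [abs_le_one_iff_mul_self_le_one]
  nlinarith [mul_nonneg (sub_nonneg.2 hx) (sq_nonneg ((U ℝ n).eval x))]

open Polynomial.Chebyshev in
/-- For `|s| ≤ √(1 - x²)` the product `s * U n` is bounded by `1` instead of `n + 1`. -/
theorem mul_abs_chebyshev_U_le_one (n : ℕ) {x s : ℝ} (hs : s ^ 2 ≤ 1 - x ^ 2) :
    |s * (U ℝ n).eval x| ≤ 1 := by
  have h := chebyshev_pell n x
  rw [abs_le_one_iff_mul_self_le_one]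
  nlinarith [mul_le_mul_of_nonneg_right hs (sq_nonneg ((U ℝ n).eval x)),
    sq_nonneg ((T ℝ (n + 1 : ℤ)).eval x)]

open Polynomial.Chebyshev in
theorem derivative_chebyshev_U_succ_eval (n : ℕ) (x : ℝ) :
    (U ℝ (n + 1 : ℕ)).derivative.eval x =
      (n + 2) * (U ℝ n).eval x + x * (U ℝ n).derivative.eval x := by
  have h := congrArg (fun p => p.derivative.eval x) (U_eq_X_mul_U_add_T ℝ n)
  simp only [Polynomial.derivative_add, Polynomial.derivative_mul, Polynomial.derivative_X,
    T_derivative_eq_U, Polynomial.eval_add, Polynomial.eval_mul, Polynomial.eval_X,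
    Polynomial.eval_one, Polynomial.eval_intCast, add_sub_cancel_right] at h
  push_cast at h ⊢
  linear_combination h

open Polynomial.Chebyshev in
theorem derivative_derivative_chebyshev_U_succ_eval (n : ℕ) (x : ℝ) :
    (U ℝ (n + 1 : ℕ)).derivative.derivative.eval x =
      (n + 3) * (U ℝ n).derivative.eval x + x * (U ℝ n).derivative.derivative.eval x := by
  have h := congrArg (fun p => p.derivative.derivative.eval x) (U_eq_X_mul_U_add_T ℝ n)
  simp only [Polynomial.derivative_add, Polynomial.derivative_mul, Polynomial.derivative_X,
    T_derivative_eq_U, Polynomial.eval_add, Polynomial.eval_mul, Polynomial.eval_X,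
    Polynomial.eval_one, Polynomial.eval_intCast, add_sub_cancel_right,
    Polynomial.derivative_intCast, Polynomial.derivative_one, Polynomial.eval_zero] at h
  push_cast at h ⊢
  linear_combination h

/-- One step of the inductive bounds on the derivatives of `U`, which satisfy recurrences of the
shape `g (n + 1) = k * p + x * g n`. -/
theorem abs_mul_add_mul_le {s k p x g P G : ℝ} (hk : 0 ≤ k) (hx : x ^ 2 ≤ 1)
    (hp : |s * p| ≤ P) (hg : |s * g| ≤ G) : |s * (k * p + x * g)| ≤ k * P + G := by
  have hx' : |x| ≤ 1 := (sq_le_one_iff_abs_le_one x).1 hx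
  calc |s * (k * p + x * g)| = |k * (s * p) + x * (s * g)| := by ring_nf
    _ ≤ |k * (s * p)| + |x * (s * g)| := abs_add_le _ _
    _ = k * |s * p| + |x| * |s * g| := by rw [abs_mul, abs_mul x, abs_of_nonneg hk]
    _ ≤ k * P + 1 * G := by gcongr
    _ = k * P + G := by ring

open Polynomial.Chebyshev in
theorem abs_chebyshev_U_le (n : ℕ) {x : ℝ} (hx : x ^ 2 ≤ 1) : |(U ℝ n).eval x| ≤ n + 1 := by
  induction n with
  | zero => simp
  | succ n ih =>
    have h := congrArg (Polynomial.eval x) (U_eq_X_mul_U_add_T ℝ n)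
    simp only [Polynomial.eval_add, Polynomial.eval_mul, Polynomial.eval_X] at h
    have := abs_mul_add_mul_le (s := 1) zero_le_one hx
      (by simpa using abs_chebyshev_T_le_one n hx) (by simpa using ih)
    push_cast
    rw [one_mul, one_mul, one_mul, add_comm] at this
    rw [h]
    linarith

open Polynomial.Chebyshev in
theorem abs_derivative_chebyshev_U_le (n : ℕ) {x : ℝ} (hx : x ^ 2 ≤ 1) :
    |(U ℝ n).derivative.eval x| ≤ (n + 1) ^ 3 := by
  induction n with
  | zero => simp
  | succ n ih =>
    have := abs_mul_add_mul_le (s := 1) (k := n + 2) (by positivity) hx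
      (by simpa using abs_chebyshev_U_le n hx) (by simpa using ih)
    rw [derivative_chebyshev_U_succ_eval]
    rw [one_mul] at this
    refine this.trans ?_
    push_cast
    have : (0 : ℝ) ≤ n := n.cast_nonneg
    nlinarith

open Polynomial.Chebyshev in
theorem abs_derivative_derivative_chebyshev_U_le (n : ℕ) {x : ℝ} (hx : x ^ 2 ≤ 1) :
    |(U ℝ n).derivative.derivative.eval x| ≤ (n + 1) ^ 5 := by
  induction n with
  | zero => simp
  | succ n ih =>
    have := abs_mul_add_mul_le (s := 1) (k := n + 3) (by positivity) hx
      (by simpa using abs_derivative_chebyshev_U_le n hx) (by simpa using ih)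
    rw [derivative_derivative_chebyshev_U_succ_eval]
    rw [one_mul] at this
    refine this.trans ?_
    push_cast
    rw [← sub_nonneg]
    ring_nf
    positivity

/-- A Bernstein-type bound: the factor `|s| ≤ √(1 - x²)` saves one power of the degree. -/
theorem mul_abs_derivative_chebyshev_U_le (n : ℕ) {x s : ℝ} (hs : s ^ 2 ≤ 1 - x ^ 2) :
    |s * (Polynomial.Chebyshev.U ℝ n).derivative.eval x| ≤ (n + 1) ^ 2 := by
  have hx : x ^ 2 ≤ 1 := by nlinarith [sq_nonneg s]
  induction n with
  | zero => simp
  | succ n ih =>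
    rw [derivative_chebyshev_U_succ_eval]
    refine (abs_mul_add_mul_le (k := n + 2) (by positivity) hx
      (mul_abs_chebyshev_U_le_one n hs) ih).trans ?_
    push_cast
    have : (0 : ℝ) ≤ n := n.cast_nonneg
    nlinarith

/-- The second-derivative counterpart of `mul_abs_derivative_chebyshev_U_le`. -/
theorem mul_abs_derivative_derivative_chebyshev_U_le (n : ℕ) {x s : ℝ} (hs : s ^ 2 ≤ 1 - x ^ 2) :
    |s * (Polynomial.Chebyshev.U ℝ n).derivative.derivative.eval x| ≤ (n + 1) ^ 4 := by
  have hx : x ^ 2 ≤ 1 := by nlinarith [sq_nonneg s]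
  induction n with
  | zero => simp
  | succ n ih =>
    rw [derivative_derivative_chebyshev_U_succ_eval]
    refine (abs_mul_add_mul_le (k := n + 3) (by positivity) hx
      (mul_abs_derivative_chebyshev_U_le n hs) ih).trans ?_
    push_cast
    rw [← sub_nonneg]
    ring_nf
    positivity

/-! ### The normalized reconstructed function as a polynomial in `cos θ` -/

open Polynomial.Chebyshev in
/-- The normalized reconstructed function of the circuit of length `n + 1`, as a polynomial in the
variable `t = cos θ`: at `t = cos θ` it equals `hHat` when `sin θ ≠ 0`, but `t` ranges over all
reals. -/
noncomputable def profile (n : ℕ) (ω t : ℝ) : ℂ :=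
  (((U ℝ n).eval (t * Real.cos ω) : ℝ) : ℂ) * ((((T ℝ (n + 1 : ℤ)).eval (t * Real.cos ω) : ℝ) : ℂ)
    + Complex.I * ((t * Real.sin ω * (U ℝ n).eval (t * Real.cos ω) : ℝ) : ℂ))

open Polynomial.Chebyshev in
/-- The derivative of `profile n ω` in the variable `t`. -/
noncomputable def profileDeriv (n : ℕ) (ω t : ℝ) : ℂ :=
  ((Real.cos ω * (U ℝ n).derivative.eval (t * Real.cos ω) : ℝ) : ℂ) *
      ((((T ℝ (n + 1 : ℤ)).eval (t * Real.cos ω) : ℝ) : ℂ)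
        + Complex.I * ((t * Real.sin ω * (U ℝ n).eval (t * Real.cos ω) : ℝ) : ℂ))
    + (((U ℝ n).eval (t * Real.cos ω) : ℝ) : ℂ) *
      (((Real.cos ω * ((n + 1) * (U ℝ n).eval (t * Real.cos ω)) : ℝ) : ℂ)
        + Complex.I * ((Real.sin ω * (U ℝ n).eval (t * Real.cos ω)
          + t * Real.sin ω * (Real.cos ω * (U ℝ n).derivative.eval (t * Real.cos ω)) : ℝ) : ℂ))

open Polynomial.Chebyshev in
/-- The second derivative of `profile n ω` in the variable `t`. -/
noncomputable def profileDerivTwo (n : ℕ) (ω t : ℝ) : ℂ :=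
  ((Real.cos ω ^ 2 * (U ℝ n).derivative.derivative.eval (t * Real.cos ω) : ℝ) : ℂ) *
      ((((T ℝ (n + 1 : ℤ)).eval (t * Real.cos ω) : ℝ) : ℂ)
        + Complex.I * ((t * Real.sin ω * (U ℝ n).eval (t * Real.cos ω) : ℝ) : ℂ))
    + 2 * ((Real.cos ω * (U ℝ n).derivative.eval (t * Real.cos ω) : ℝ) : ℂ) *
      (((Real.cos ω * ((n + 1) * (U ℝ n).eval (t * Real.cos ω)) : ℝ) : ℂ)
        + Complex.I * ((Real.sin ω * (U ℝ n).eval (t * Real.cos ω)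
          + Real.cos ω * (t * Real.sin ω * (U ℝ n).derivative.eval (t * Real.cos ω)) : ℝ) : ℂ))
    + (((U ℝ n).eval (t * Real.cos ω) : ℝ) : ℂ) *
      (((Real.cos ω ^ 2 * ((n + 1) * (U ℝ n).derivative.eval (t * Real.cos ω)) : ℝ) : ℂ)
        + Complex.I * ((2 * (Real.cos ω * (Real.sin ω * (U ℝ n).derivative.eval (t * Real.cos ω)))
          + Real.cos ω ^ 2 *
            (t * Real.sin ω * (U ℝ n).derivative.derivative.eval (t * Real.cos ω)) : ℝ) : ℂ))

theorem hasDerivAt_eval_mul_const (p : Polynomial ℝ) (a t : ℝ) :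
    HasDerivAt (fun t => p.eval (t * a)) (a * p.derivative.eval (t * a)) t := by
  have h := (p.hasDerivAt (t * a)).comp t ((hasDerivAt_id t).mul_const a)
  rw [one_mul, mul_comm] at h
  exact h

open Polynomial.Chebyshev in
theorem derivative_chebyshev_T_eval (n : ℕ) (x : ℝ) :
    (T ℝ (n + 1 : ℤ)).derivative.eval x = (n + 1) * (U ℝ n).eval x := by
  rw [T_derivative_eq_U]
  simp

theorem hasDerivAt_profile (n : ℕ) (ω t : ℝ) :
    HasDerivAt (profile n ω) (profileDeriv n ω t) t := by
  have hU := hasDerivAt_eval_mul_const (Polynomial.Chebyshev.U ℝ n) (Real.cos ω) t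
  have hT := hasDerivAt_eval_mul_const (Polynomial.Chebyshev.T ℝ (n + 1 : ℤ)) (Real.cos ω) t
  have hS := ((hasDerivAt_id t).mul_const (Real.sin ω)).mul hU
  have h := hU.ofReal_comp.mul (hT.ofReal_comp.add (hS.ofReal_comp.const_mul Complex.I))
  refine h.congr_deriv ?_
  simp only [profileDeriv, derivative_chebyshev_T_eval, one_mul, id, Pi.add_apply, Pi.mul_apply]

theorem hasDerivAt_profileDeriv (n : ℕ) (ω t : ℝ) :
    HasDerivAt (profileDeriv n ω) (profileDerivTwo n ω t) t := by
  have hU := hasDerivAt_eval_mul_const (Polynomial.Chebyshev.U ℝ n) (Real.cos ω) t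
  have hU' := hasDerivAt_eval_mul_const (Polynomial.Chebyshev.U ℝ n).derivative (Real.cos ω) t
  have hT := hasDerivAt_eval_mul_const (Polynomial.Chebyshev.T ℝ (n + 1 : ℤ)) (Real.cos ω) t
  have hs := (hasDerivAt_id t).mul_const (Real.sin ω)
  have h := ((hU'.const_mul (Real.cos ω)).ofReal_comp.mul
      (hT.ofReal_comp.add ((hs.mul hU).ofReal_comp.const_mul Complex.I))).add
    (hU.ofReal_comp.mul (((hU.const_mul ((n : ℝ) + 1)).const_mul (Real.cos ω)).ofReal_comp.add
      (((hU.const_mul (Real.sin ω)).add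
        (hs.mul (hU'.const_mul (Real.cos ω)))).ofReal_comp.const_mul Complex.I)))
  refine h.congr_deriv ?_
  simp only [profileDerivTwo, derivative_chebyshev_T_eval, one_mul, id, Pi.add_apply, Pi.mul_apply]
  push_cast
  ring

/-! ### The Taylor estimate in `cos θ` -/

theorem norm_ofReal_add_I_mul_ofReal_le (p q : ℝ) :
    ‖(p : ℂ) + Complex.I * (q : ℂ)‖ ≤ |p| + |q| := by
  refine (norm_add_le _ _).trans_eq ?_
  simp

theorem norm_profileDerivTwo_le (n : ℕ) (ω : ℝ) {t : ℝ} (ht : t ^ 2 ≤ 1) :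
    ‖profileDerivTwo n ω t‖ ≤ 16 * ((n : ℝ) + 1) ^ 5 := by
  set x := t * Real.cos ω with hx
  have ha : |Real.cos ω| ≤ 1 := Real.abs_cos_le_one ω
  have ha2 : |Real.cos ω ^ 2| ≤ 1 := by rw [abs_pow]; exact pow_le_one₀ (abs_nonneg _) ha
  have hb : |Real.sin ω| ≤ 1 := Real.abs_sin_le_one ω
  have hsc := Real.sin_sq_add_cos_sq ω
  have hb1 : Real.sin ω ^ 2 ≤ 1 - x ^ 2 := by
    rw [hx, mul_pow]; nlinarith [mul_le_mul_of_nonneg_right ht (sq_nonneg (Real.cos ω))]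
  have hb2 : (t * Real.sin ω) ^ 2 ≤ 1 - x ^ 2 := by
    rw [hx, mul_pow, mul_pow]; nlinarith
  have hx1 : x ^ 2 ≤ 1 := by nlinarith [sq_nonneg (Real.sin ω)]
  have hT := abs_chebyshev_T_le_one n hx1
  have hU := abs_chebyshev_U_le n hx1
  have hU1 := abs_derivative_chebyshev_U_le n hx1
  have hU2 := abs_derivative_derivative_chebyshev_U_le n hx1
  have hS := mul_abs_chebyshev_U_le_one n hb1
  have hS' := mul_abs_chebyshev_U_le_one n hb2
  have hS1 := mul_abs_derivative_chebyshev_U_le n hb1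
  have hS1' := mul_abs_derivative_chebyshev_U_le n hb2
  have hS2 := mul_abs_derivative_derivative_chebyshev_U_le n hb2
  unfold profileDerivTwo
  rw [← hx]
  -- The occurrences of `sin ω` absorb one power of `d`, which keeps every term of order `d ^ 5`.
  have key : ∀ {a p B : ℝ}, |a| ≤ 1 → |p| ≤ B → |a * p| ≤ B := fun h h' => by
    rw [abs_mul]
    exact (mul_le_of_le_one_left (abs_nonneg _) h).trans h'
  have hd : (1 : ℝ) ≤ n + 1 := by simp
  set d : ℝ := (n : ℝ) + 1 with hd_def
  have hdU : ∀ {p B : ℝ}, |p| ≤ B → |d * p| ≤ d * B := fun h => by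
    rw [abs_mul, abs_of_nonneg (by positivity : (0 : ℝ) ≤ d)]
    gcongr
  have h1 := (norm_ofReal_add_I_mul_ofReal_le _ _).trans (add_le_add hT hS')
  have h2 := (norm_ofReal_add_I_mul_ofReal_le _ _).trans (add_le_add (key ha (hdU hU))
    ((abs_add_le _ _).trans (add_le_add hS (key ha hS1'))))
  have h3 := (norm_ofReal_add_I_mul_ofReal_le _ _).trans (add_le_add (key ha2 (hdU hU1))
    ((abs_add_le _ _).trans (add_le_add ((abs_mul _ _).trans_le (mul_le_mul_of_nonneg_left
      (key ha hS1) (abs_nonneg 2))) (key ha2 hS2))))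
  refine (norm_add₃_le).trans ?_
  rw [norm_mul, norm_mul, norm_mul, norm_mul, Complex.norm_real, Complex.norm_real,
    Complex.norm_real, Complex.norm_ofNat, Real.norm_eq_abs, Real.norm_eq_abs, Real.norm_eq_abs]
  calc _ ≤ d ^ 5 * (1 + 1) + 2 * d ^ 3 * (d * d + (1 + d ^ 2))
        + d * (d * d ^ 3 + (|2| * d ^ 2 + d ^ 4)) := by
        gcongr
        · exact key ha2 hU2
        · exact key ha hU1
    _ = 8 * d ^ 5 + 4 * d ^ 3 := by rw [abs_two]; ring
    _ ≤ 16 * d ^ 5 := by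
        have : d ^ 3 ≤ d ^ 5 := pow_le_pow_right₀ hd (by norm_num)
        linarith [pow_nonneg (zero_le_one.trans hd) 5]

/-- The first-order Taylor estimate at `1`, with the sharp constant `C / 2`, for functions with
values in a normed space. -/
theorem norm_sub_taylor_one_le {E : Type*} [NormedAddCommGroup E] [NormedSpace ℝ E]
    {f f' f'' : ℝ → E} {C c : ℝ} (hf : ∀ t, HasDerivAt f (f' t) t)
    (hf' : ∀ t, HasDerivAt f' (f'' t) t) (hC : ∀ t ∈ Set.Icc c 1, ‖f'' t‖ ≤ C) (hc : c ≤ 1) :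
    ‖f c - (f 1 - (1 - c) • f' 1)‖ ≤ C / 2 * (1 - c) ^ 2 := by
  -- The fencing theorem runs forward from the left end point, so `t = 1 - s` with `s` growing.
  have hsub : ∀ s : ℝ, HasDerivAt (fun s : ℝ => 1 - s) (-1) s := fun s =>
    (hasDerivAt_id s).const_sub 1
  have hcomp : ∀ s : ℝ, HasDerivAt (fun s => f (1 - s)) (-f' (1 - s)) s := fun s => by
    simpa [Function.comp_def] using (hf (1 - s)).scomp s (hsub s)
  have hg : ∀ s : ℝ, HasDerivAt (fun s => f (1 - s) - (f 1 - s • f' 1)) (-f' (1 - s) + f' 1) s :=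
    fun s =>
      ((hcomp s).sub (((hasDerivAt_id s).smul_const (f' 1)).const_sub (f 1))).congr_deriv
        (by simp)
  have hB : ∀ s : ℝ, HasDerivAt (fun s => C / 2 * s ^ 2) (C * s) s := fun s =>
    ((hasDerivAt_pow 2 s).const_mul (C / 2)).congr_deriv (by simp; ring)
  have hbound : ∀ s ∈ Set.Ico (0 : ℝ) (1 - c), ‖-f' (1 - s) + f' 1‖ ≤ C * s := fun s hs => by
    have h := (convex_Icc c 1).norm_image_sub_le_of_norm_hasDerivWithin_le
      (fun t _ => (hf' t).hasDerivWithinAt) hC (x := 1 - s) (y := 1)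
      ⟨by linarith [hs.2], by linarith [hs.1]⟩ ⟨hc, le_rfl⟩
    rw [sub_sub_cancel, Real.norm_of_nonneg hs.1] at h
    rwa [neg_add_eq_sub]
  have := image_norm_le_of_norm_deriv_right_le_deriv_boundary (a := 0) (b := 1 - c)
    (fun s _ => (hg s).continuousAt.continuousWithinAt) (fun s _ => (hg s).hasDerivWithinAt)
    (by simp) hB hbound (x := 1 - c) ⟨by linarith, le_rfl⟩
  simpa using this

theorem norm_profile_sub_taylor_le (n : ℕ) (ω θ : ℝ) :
    ‖profile n ω (Real.cos θ)
      - (profile n ω 1 - ((1 - Real.cos θ : ℝ) : ℂ) * profileDeriv n ω 1)‖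
      ≤ 2 * ((n : ℝ) + 1) ^ 5 * θ ^ 4 := by
  have h := norm_sub_taylor_one_le (C := 16 * ((n : ℝ) + 1) ^ 5) (hasDerivAt_profile n ω)
    (hasDerivAt_profileDeriv n ω) (c := Real.cos θ)
    (fun t ht => norm_profileDerivTwo_le n ω
      (by nlinarith [ht.1, ht.2, Real.neg_one_le_cos θ])) (Real.cos_le_one θ)
  rw [Complex.real_smul] at h
  have hcos : 1 - Real.cos θ ≤ θ ^ 2 / 2 := by linarith [Real.one_sub_sq_div_two_le_cos (x := θ)]
  calc _ ≤ _ := h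
    _ ≤ 16 * ((n : ℝ) + 1) ^ 5 / 2 * (θ ^ 2 / 2) ^ 2 := by
      gcongr
      linarith [Real.cos_le_one θ]
    _ = _ := by ring

/-! ### The circuit in terms of Chebyshev polynomials -/

/-- The powers of a matrix satisfying the Cayley-Hamilton relation with determinant `1` and trace
`2 * x` are given by Chebyshev polynomials of the second kind. -/
theorem pow_succ_eq_chebyshev_U {ι R : Type*} [Fintype ι] [DecidableEq ι] [CommRing R]
    {M : Matrix ι ι R} {x : R} (hM : M * M = (2 * x) • M - 1) (n : ℕ) :
    M ^ (n + 1) = (Polynomial.Chebyshev.U R n).eval x • M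
      - (Polynomial.Chebyshev.U R (n - 1 : ℤ)).eval x • (1 : Matrix ι ι R) := by
  induction n with
  | zero => simp
  | succ n ih =>
    have hU := congrArg (Polynomial.eval x) (Polynomial.Chebyshev.U_add_one R n)
    simp only [Polynomial.eval_sub, Polynomial.eval_mul, Polynomial.eval_X,
      Polynomial.eval_ofNat] at hU
    rw [pow_succ, ih, sub_mul, smul_mul_assoc, smul_mul_assoc, hM, one_mul]
    push_cast
    rw [add_sub_cancel_right, hU]
    module

/-- Shifting `ω` by `φ` removes `φ` from the diagonal; off the diagonal only the sum `ω + φ + χ`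
remains. -/
theorem zRotation_mul_fsimGate (ω θ φ χ : ℝ) :
    zRotation (ω + φ) * fsimGate θ φ χ =
      !![Complex.exp (Complex.I * ω) * (Real.cos θ : ℂ),
        -Complex.I * Complex.exp (Complex.I * (ω + φ + χ)) * (Real.sin θ : ℂ);
        -Complex.I * Complex.exp (-(Complex.I * (ω + φ + χ))) * (Real.sin θ : ℂ),
        Complex.exp (-(Complex.I * ω)) * (Real.cos θ : ℂ)] := by
  rw [zRotation, fsimGate, Matrix.mul_fin_two]
  congr 1
  ext i j
  fin_cases i <;> fin_cases j <;> simp only [Complex.ofReal_add] <;> simp <;> ring_nf <;>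
    simp only [mul_assoc, ← Complex.exp_add] <;> ring_nf

/-- The Cayley-Hamilton relation of the single-step matrix, whose determinant is `1`. -/
theorem zRotation_mul_fsimGate_mul_self (ω θ φ χ : ℝ) :
    zRotation (ω + φ) * fsimGate θ φ χ * (zRotation (ω + φ) * fsimGate θ φ χ) =
      (2 * ((Real.cos θ * Real.cos ω : ℝ) : ℂ)) • (zRotation (ω + φ) * fsimGate θ φ χ) - 1 := by
  have h1 : Complex.exp (Complex.I * ω) * Complex.exp (-(Complex.I * ω)) = 1 := by
    rw [← Complex.exp_add]; simp
  have h2 : Complex.exp (Complex.I * (ω + φ + χ)) * Complex.exp (-(Complex.I * (ω + φ + χ))) = 1 := by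
    rw [← Complex.exp_add]; simp
  have h3 : 2 * Complex.cos ω = Complex.exp (Complex.I * ω) + Complex.exp (-(Complex.I * ω)) := by
    rw [Complex.two_cos]; ring_nf
  have h4 := Complex.sin_sq_add_cos_sq θ
  have h5 := Complex.I_sq
  rw [zRotation_mul_fsimGate]
  generalize Complex.exp (Complex.I * ω) = z at *
  generalize Complex.exp (-(Complex.I * ω)) = z' at *
  generalize Complex.exp (Complex.I * (ω + φ + χ)) = w at *
  generalize Complex.exp (-(Complex.I * (ω + φ + χ))) = w' at *
  push_cast
  have h6 : 2 * (Complex.cos θ * Complex.cos ω) = Complex.cos θ * (z + z') := by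
    linear_combination Complex.cos θ * h3
  rw [Matrix.mul_fin_two, h6, Matrix.one_fin_two]
  generalize Complex.cos θ = c at *
  generalize Complex.sin θ = s at *
  ext i j
  fin_cases i <;> fin_cases j <;> simp
  · linear_combination (-c ^ 2) * h1 - s ^ 2 * h2 - h4 + w * w' * s ^ 2 * h5
  · ring
  · ring
  · linear_combination (-c ^ 2) * h1 - s ^ 2 * h2 - h4 + w * w' * s ^ 2 * h5

/-- The two transition probabilities of a unitary row `(P, Q)` recover `P * conj Q`. -/
theorem interference_eq_mul_conj {P Q : ℂ} (h : ‖P‖ ^ 2 + ‖Q‖ ^ 2 = 1) :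
    ((‖P * (1 / (Real.sqrt 2 : ℂ)) + Q * (1 / (Real.sqrt 2 : ℂ))‖ ^ 2 - 1 / 2 : ℝ) : ℂ)
      + Complex.I *
        ((‖P * (1 / (Real.sqrt 2 : ℂ)) + Q * (Complex.I / (Real.sqrt 2 : ℂ))‖ ^ 2 - 1 / 2 : ℝ) : ℂ)
      = P * (starRingEnd ℂ) Q := by
  have h2 : ‖(Real.sqrt 2 : ℂ)‖ ^ 2 = 2 := by
    rw [Complex.norm_real, Real.norm_eq_abs, sq_abs]; exact Real.sq_sqrt zero_le_two
  rw [show P * (1 / (Real.sqrt 2 : ℂ)) + Q * (1 / (Real.sqrt 2 : ℂ)) = (P + Q) / (Real.sqrt 2 : ℂ)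
    by ring, show P * (1 / (Real.sqrt 2 : ℂ)) + Q * (Complex.I / (Real.sqrt 2 : ℂ))
      = (P + Q * Complex.I) / (Real.sqrt 2 : ℂ) by ring, norm_div, norm_div, div_pow, div_pow, h2]
  simp only [Complex.sq_norm, Complex.normSq_apply] at h ⊢
  apply Complex.ext <;> simp <;> linarith

/-- The phase-free reconstructed function is `sin θ * e^{-iω}` times the polynomial `profile` at
`cos θ`; no assumption on `sin θ` is needed. -/
theorem hTilde_eq (n : ℕ) (ω θ φ χ : ℝ) :
    hTilde (n + 1) ω θ φ χ =
      (Real.sin θ : ℂ) * Complex.exp (-(Complex.I * ω)) * profile n ω (Real.cos θ) := by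
  set x := Real.cos θ * Real.cos ω with hx
  set u := (Polynomial.Chebyshev.U ℝ n).eval x with hu
  set v := (Polynomial.Chebyshev.T ℝ (n + 1 : ℤ)).eval x with hv
  have hpow := pow_succ_eq_chebyshev_U (zRotation_mul_fsimGate_mul_self ω θ φ χ) n
  rw [← hx, ← Polynomial.Chebyshev.complex_ofReal_eval_U,
    ← Polynomial.Chebyshev.complex_ofReal_eval_U, ← hu] at hpow
  have hT : (Polynomial.Chebyshev.U ℝ (n - 1 : ℤ)).eval x = x * u - v := by
    have h := congrArg (Polynomial.eval x) (Polynomial.Chebyshev.T_eq_X_mul_U_sub_U ℝ (n - 1 : ℤ))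
    simp only [Polynomial.eval_sub, Polynomial.eval_mul, Polynomial.eval_X] at h
    rw [show (n : ℤ) - 1 + 2 = n + 1 by ring, show (n : ℤ) - 1 + 1 = n by ring] at h
    linarith
  have hexp : Complex.exp (Complex.I * ω) = (Real.cos ω : ℂ) + Complex.I * (Real.sin ω : ℂ) := by
    rw [mul_comm, Complex.exp_mul_I]; push_cast; ring
  have hP : ((zRotation (ω + φ) * fsimGate θ φ χ) ^ (n + 1)) 0 0 =
      (v : ℂ) + Complex.I * ((Real.cos θ * Real.sin ω * u : ℝ) : ℂ) := by
    rw [hpow, zRotation_mul_fsimGate, hT, hexp]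
    simp [hx]
    ring
  have hQ : ((zRotation (ω + φ) * fsimGate θ φ χ) ^ (n + 1)) 0 1 =
      -Complex.I * Complex.exp (Complex.I * (ω + φ + χ)) * ((Real.sin θ * u : ℝ) : ℂ) := by
    rw [hpow, zRotation_mul_fsimGate]
    simp
    ring
  have hphase : ‖Complex.exp (Complex.I * (ω + φ + χ))‖ = 1 := by
    rw [mul_comm]; exact_mod_cast Complex.norm_exp_ofReal_mul_I (ω + φ + χ)
  have hrow : ‖((zRotation (ω + φ) * fsimGate θ φ χ) ^ (n + 1)) 0 0‖ ^ 2
      + ‖((zRotation (ω + φ) * fsimGate θ φ χ) ^ (n + 1)) 0 1‖ ^ 2 = 1 := by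
    have hpell : v ^ 2 + (1 - x ^ 2) * u ^ 2 = 1 := chebyshev_pell n x
    rw [hP, hQ, norm_mul, norm_mul, hphase, norm_neg, Complex.norm_I, Complex.norm_real,
      Complex.sq_norm, mul_comm Complex.I, Complex.normSq_add_mul_I, Real.norm_eq_abs, one_mul,
      one_mul, sq_abs]
    linear_combination hpell + u ^ 2 * Real.sin_sq_add_cos_sq θ
      + Real.cos θ ^ 2 * u ^ 2 * Real.sin_sq_add_cos_sq ω
  have hrec : reconstructed (n + 1) (ω + φ) θ φ χ =
      ((zRotation (ω + φ) * fsimGate θ φ χ) ^ (n + 1)) 0 0 *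
        (starRingEnd ℂ) (((zRotation (ω + φ) * fsimGate θ φ χ) ^ (n + 1)) 0 1) := by
    rw [← interference_eq_mul_conj hrow]
    simp only [reconstructed, probX, probY, transitionProb, bellPlus, bellI, qspcCircuit,
      Matrix.mulVec, dotProduct, Fin.sum_univ_two, Matrix.cons_val_zero, Matrix.cons_val_one]
  have hne : Complex.I * Complex.exp (-(Complex.I * (χ + φ))) ≠ 0 :=
    mul_ne_zero Complex.I_ne_zero (Complex.exp_ne_zero _)
  have hconj : (starRingEnd ℂ) (Complex.exp (Complex.I * (ω + φ + χ)))
      = Complex.exp (-(Complex.I * (χ + φ))) * Complex.exp (-(Complex.I * ω)) := by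
    rw [← Complex.exp_conj, ← Complex.exp_add]
    congr 1
    simp
    ring
  rw [hTilde, div_eq_iff hne]
  rw [hrec, hP, hQ, map_mul, map_mul, hconj, map_neg, Complex.conj_I, Complex.conj_ofReal, profile,
    ← hx, ← hu, ← hv]
  push_cast
  ring

/-! ### The approximation as a Taylor polynomial -/

/-- Summation of a quadratic polynomial against a geometric progression. -/
theorem sub_one_pow_three_mul_sum_quadratic_mul_pow (A B C w : ℂ) (N : ℕ) :
    (w - 1) ^ 3 * ∑ k ∈ Finset.range N, (A + B * k + C * k ^ 2) * w ^ k =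
      w ^ N * ((w - 1) ^ 2 * (A + B * N + C * N ^ 2) - w * (w - 1) * (B + C * (2 * N + 1))
        + 2 * w ^ 2 * C)
      - ((w - 1) ^ 2 * A - w * (w - 1) * (B + C) + 2 * w ^ 2 * C) := by
  induction N with
  | zero => simp
  | succ N ih =>
    rw [Finset.sum_range_succ, mul_add, ih, pow_succ]
    push_cast
    ring

theorem sum_Icc_neg_eq (g : ℤ → ℂ) (n : ℕ) :
    ∑ k ∈ Finset.Icc (-(n : ℤ)) n, g k =
      ∑ k ∈ Finset.range (n + 1), g k + ∑ k ∈ Finset.range n, g (-(k + 1 : ℤ)) := by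
  induction n with
  | zero => simp
  | succ n ih =>
    have : Finset.Icc (-((n + 1 : ℕ) : ℤ)) ((n + 1 : ℕ) : ℤ)
        = insert (-((n : ℤ) + 1)) (insert ((n : ℤ) + 1) (Finset.Icc (-(n : ℤ)) n)) := by
      ext k; simp only [Finset.mem_Icc, Finset.mem_insert]; push_cast; omega
    rw [this, Finset.sum_insert, Finset.sum_insert, ih, Finset.sum_range_succ (fun k : ℕ => g k) (n + 1),
      Finset.sum_range_succ (fun k : ℕ => g (-(k + 1 : ℤ))) n]
    · push_cast; ring
    · simp
    · simp only [Finset.mem_Icc, Finset.mem_insert]; omega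

/-- `hStar` as a geometric sum plus `1 - cos θ` times two quadratic-geometric sums, over the
nonnegative and the negative frequencies `k = -(j + 1)`. -/
theorem hStar_eq_sum (n : ℕ) (ω θ : ℝ) :
    hStar (n + 1) ω θ =
      Complex.exp (Complex.I * ω) *
        ∑ k ∈ Finset.range (n + 1), (Complex.exp (Complex.I * ω) ^ 2) ^ k
      - ((1 - Real.cos θ : ℝ) : ℂ) *
        (Complex.exp (Complex.I * ω) * ∑ k ∈ Finset.range (n + 1),
          ((((n : ℂ) + 1) ^ 2 + (n + 1) - 1) + (2 * ((n : ℂ) + 1) - 3) * k + (-3) * k ^ 2)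
            * (Complex.exp (Complex.I * ω) ^ 2) ^ k
        + Complex.exp (-(Complex.I * ω)) * ∑ k ∈ Finset.range (n + 1),
          ((((n : ℂ) + 1) ^ 2 - (n + 1)) + (1 - 2 * ((n : ℂ) + 1)) * k + 1 * k ^ 2)
            * (Complex.exp (-(Complex.I * ω)) ^ 2) ^ k) := by
  have hexp : ∀ k : ℕ, Complex.exp (Complex.I * (2 * k + 1) * ω)
      = Complex.exp (Complex.I * ω) * (Complex.exp (Complex.I * ω) ^ 2) ^ k := fun k => by
    rw [← pow_mul, ← Complex.exp_nat_mul, ← Complex.exp_add]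
    congr 1; push_cast; ring
  have hexp' : ∀ k : ℕ, Complex.exp (Complex.I * (2 * (-(k + 1)) + 1) * ω)
      = Complex.exp (-(Complex.I * ω)) * (Complex.exp (-(Complex.I * ω)) ^ 2) ^ k := fun k => by
    rw [← pow_mul, ← Complex.exp_nat_mul, ← Complex.exp_add]
    congr 1; push_cast; ring
  rw [hStar, show -((n + 1 : ℕ) : ℤ) + 1 = -(n : ℤ) by push_cast; ring,
    show ((n + 1 : ℕ) : ℤ) - 1 = n by push_cast; ring, sum_Icc_neg_eq]
  -- The coefficient with `k = -d` vanishes, which makes both sums run over the same range.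
  rw [Finset.sum_range_succ (fun k : ℕ => ((((n : ℂ) + 1) ^ 2 - (n + 1))
    + (1 - 2 * ((n : ℂ) + 1)) * k + 1 * k ^ 2) * (Complex.exp (-(Complex.I * ω)) ^ 2) ^ k) n,
    show (((n : ℂ) + 1) ^ 2 - (n + 1)) + (1 - 2 * ((n : ℂ) + 1)) * n + 1 * n ^ 2 = 0 by ring,
    zero_mul, add_zero, mul_add, Finset.mul_sum, Finset.mul_sum, Finset.mul_sum, Finset.mul_sum,
    Finset.mul_sum, ← sub_sub, ← Finset.sum_sub_distrib, sub_eq_add_neg, ← Finset.sum_neg_distrib]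
  congr 1
  · refine Finset.sum_congr rfl fun k _ => ?_
    have := hexp k
    rw [cStar, if_pos (Int.natCast_nonneg k)]
    push_cast at this ⊢
    rw [this]
    ring
  · refine Finset.sum_congr rfl fun k _ => ?_
    have := hexp' k
    rw [cStar, if_neg (by omega)]
    push_cast at this ⊢
    rw [this]
    ring

/-- The value of `profile` at `t = 1` in terms of `z = e^{iω}` and `y = z ^ d`, for `u`, `v` the
values of `U` and `T` at `cos ω` and `S` the geometric sum. -/
theorem profile_one_algebra {z y u v S : ℂ} (hz : z ≠ 0) (hy : y ≠ 0) (hz1 : z ^ 2 - 1 ≠ 0)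
    (hu : u * (z - z⁻¹) = y - y⁻¹) (hv : v = (y + y⁻¹) / 2) (hS : S * (z ^ 2 - 1) = y ^ 2 - 1) :
    u * (v + (z - z⁻¹) / 2 * u) = z * S := by
  have hw : z - z⁻¹ ≠ 0 := by
    rw [show z - z⁻¹ = (z ^ 2 - 1) / z by field_simp]; exact div_ne_zero hz1 hz
  rw [eq_div_of_mul_eq hw hu, eq_div_of_mul_eq hz1 hS, hv]
  rw [show z - z⁻¹ = (z ^ 2 - 1) / z by field_simp]
  field_simp
  ring

/-- The derivative of `profile` at `t = 1` in terms of `z = e^{iω}` and `y = z ^ d`, for `u`, `v`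
the values of `U` and `T` at `cos ω`, `u'` that of the derivative of `U`, and `S`, `S'` the sums
over the nonnegative and the negative frequencies. -/
theorem profileDeriv_one_algebra {z y D u u' v S S' : ℂ} (hz : z ≠ 0) (hy : y ≠ 0)
    (hz1 : z ^ 2 - 1 ≠ 0) (hu : u * (z - z⁻¹) = y - y⁻¹) (hv : v = (y + y⁻¹) / 2)
    (hu' : u' * -(z - z⁻¹) ^ 2 = 4 * ((z + z⁻¹) / 2 * u - D * v))
    (hS : (z ^ 2 - 1) ^ 3 * S = y ^ 2 * ((z ^ 2 - 1) ^ 2 * ((D ^ 2 + D - 1) + (2 * D - 3) * D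
      + (-3) * D ^ 2) - z ^ 2 * (z ^ 2 - 1) * ((2 * D - 3) + (-3) * (2 * D + 1))
      + 2 * (z ^ 2) ^ 2 * (-3)) - ((z ^ 2 - 1) ^ 2 * (D ^ 2 + D - 1)
      - z ^ 2 * (z ^ 2 - 1) * ((2 * D - 3) + (-3)) + 2 * (z ^ 2) ^ 2 * (-3)))
    (hS' : (z⁻¹ ^ 2 - 1) ^ 3 * S' = y⁻¹ ^ 2 * ((z⁻¹ ^ 2 - 1) ^ 2 * ((D ^ 2 - D) + (1 - 2 * D) * D
      + 1 * D ^ 2) - z⁻¹ ^ 2 * (z⁻¹ ^ 2 - 1) * ((1 - 2 * D) + 1 * (2 * D + 1))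
      + 2 * (z⁻¹ ^ 2) ^ 2 * 1) - ((z⁻¹ ^ 2 - 1) ^ 2 * (D ^ 2 - D)
      - z⁻¹ ^ 2 * (z⁻¹ ^ 2 - 1) * ((1 - 2 * D) + 1) + 2 * (z⁻¹ ^ 2) ^ 2 * 1)) :
    (z + z⁻¹) / 2 * u' * (v + (z - z⁻¹) / 2 * u)
      + u * ((z + z⁻¹) / 2 * (D * u) + (z - z⁻¹) / 2 * (u + (z + z⁻¹) / 2 * u'))
      = z * S + z⁻¹ * S' := by
  have hw' : z - z⁻¹ = (z ^ 2 - 1) / z := by field_simp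
  have hw : z - z⁻¹ ≠ 0 := by rw [hw']; exact div_ne_zero hz1 hz
  have hw2 : z⁻¹ ^ 2 - 1 = -(z ^ 2 - 1) / z ^ 2 := by field_simp; ring
  have hw3 : z⁻¹ ^ 2 - 1 ≠ 0 := by
    rw [hw2]; exact div_ne_zero (neg_ne_zero.2 hz1) (pow_ne_zero _ hz)
  rw [eq_div_of_mul_eq (neg_ne_zero.2 (pow_ne_zero 2 hw)) hu', eq_div_of_mul_eq hw hu, hv,
    eq_div_of_mul_eq (pow_ne_zero 3 hz1) ((mul_comm _ _).trans hS),
    eq_div_of_mul_eq (pow_ne_zero 3 hw3) ((mul_comm _ _).trans hS'), hw', hw2]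
  field_simp
  ring

/-- Away from `sin ω = 0`, the first-order Taylor polynomial of `profile` at `t = 1` is `hStar`:
both sides are rational functions of `z = e^{iω}` and `z ^ d`. -/
theorem taylor_profile_eq_hStar_of_sin_ne_zero (n : ℕ) (θ : ℝ) {ω : ℝ} (hω : Real.sin ω ≠ 0) :
    profile n ω 1 - ((1 - Real.cos θ : ℝ) : ℂ) * profileDeriv n ω 1 = hStar (n + 1) ω θ := by
  set z := Complex.exp (Complex.I * ω) with hz_def
  have hzi : Complex.exp (-(Complex.I * ω)) = z⁻¹ := Complex.exp_neg _
  have hz : z ≠ 0 := Complex.exp_ne_zero _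
  have hy : z ^ (n + 1) ≠ 0 := pow_ne_zero _ hz
  have hyz : z ^ (n + 1) = Complex.exp (((n + 1 : ℝ) * ω : ℝ) * Complex.I) := by
    rw [hz_def, ← Complex.exp_nat_mul]; push_cast; ring_nf
  have hcos : (Real.cos ω : ℂ) = (z + z⁻¹) / 2 := by
    rw [← hzi, hz_def, Complex.ofReal_cos, Complex.cos]; ring_nf
  have hsin : Complex.I * (Real.sin ω : ℂ) = (z - z⁻¹) / 2 := by
    rw [← hzi, hz_def, Complex.ofReal_sin, Complex.sin]; ring_nf; rw [Complex.I_sq]; ring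
  have hz1 : z ^ 2 - 1 ≠ 0 := fun h => by
    have : Complex.I * (Real.sin ω : ℂ) = 0 := by
      rw [hsin, show (z - z⁻¹) / 2 = (z ^ 2 - 1) / z / 2 by field_simp, h, zero_div, zero_div]
    simp [-Complex.ofReal_sin, hω] at this
  set u := (Polynomial.Chebyshev.U ℝ n).eval (Real.cos ω) with hu_def
  set u' := (Polynomial.Chebyshev.U ℝ n).derivative.eval (Real.cos ω) with hu'_def
  set v := (Polynomial.Chebyshev.T ℝ (n + 1 : ℤ)).eval (Real.cos ω) with hv_def
  have hu : (u : ℂ) * (z - z⁻¹) = z ^ (n + 1) - (z ^ (n + 1))⁻¹ := by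
    have h := Polynomial.Chebyshev.U_real_cos ω n
    rw [← hu_def] at h
    have h' : (u : ℂ) * (Real.sin ω : ℂ) = (Real.sin ((n + 1 : ℝ) * ω) : ℂ) := by
      rw [← Complex.ofReal_mul, h]; push_cast; rfl
    rw [show z - z⁻¹ = 2 * (Complex.I * (Real.sin ω : ℂ)) by rw [hsin]; ring, hyz,
      ← Complex.exp_neg, ← neg_mul, show (u : ℂ) * (2 * (Complex.I * (Real.sin ω : ℂ)))
        = 2 * (u * (Real.sin ω : ℂ)) * Complex.I by ring, h', Complex.ofReal_sin, Complex.two_sin]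
    ring_nf; rw [Complex.I_sq]; ring
  have hv : (v : ℂ) = (z ^ (n + 1) + (z ^ (n + 1))⁻¹) / 2 := by
    have h := Polynomial.Chebyshev.T_real_cos ω (n + 1)
    rw [← hv_def] at h
    rw [h, hyz, ← Complex.exp_neg, ← neg_mul, Complex.ofReal_cos, Complex.cos]
    push_cast; rfl
  have hu' : (u' : ℂ) * -(z - z⁻¹) ^ 2 = 4 * ((z + z⁻¹) / 2 * u - (n + 1) * v) := by
    have h := congrArg (Polynomial.eval (Real.cos ω))
      (Polynomial.Chebyshev.add_one_mul_T_eq_poly_in_U (R := ℝ) n)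
    simp only [Polynomial.eval_sub, Polynomial.eval_mul, Polynomial.eval_X, Polynomial.eval_add,
      Polynomial.eval_one, Polynomial.eval_pow, Polynomial.eval_intCast, ← hu_def, ← hu'_def,
      ← hv_def] at h
    have h' : ((n : ℂ) + 1) * v = Real.cos ω * u - (1 - (Real.cos ω : ℂ) ^ 2) * u' := by
      exact_mod_cast h
    rw [hcos] at h'
    have hzz : z * z⁻¹ = 1 := mul_inv_cancel₀ hz
    linear_combination 4 * h' + 4 * u' * hzz
  have hpow : (z ^ 2) ^ (n + 1) = (z ^ (n + 1)) ^ 2 := by rw [← pow_mul, ← pow_mul, mul_comm]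
  have hpow' : (z⁻¹ ^ 2) ^ (n + 1) = (z ^ (n + 1))⁻¹ ^ 2 := by
    rw [← pow_mul, ← inv_pow, ← pow_mul, mul_comm]
  have hS := sub_one_pow_three_mul_sum_quadratic_mul_pow
    (((n : ℂ) + 1) ^ 2 + (n + 1) - 1) (2 * ((n : ℂ) + 1) - 3) (-3) (z ^ 2) (n + 1)
  have hS' := sub_one_pow_three_mul_sum_quadratic_mul_pow
    (((n : ℂ) + 1) ^ 2 - (n + 1)) (1 - 2 * ((n : ℂ) + 1)) 1 (z⁻¹ ^ 2) (n + 1)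
  rw [hpow] at hS
  rw [hpow'] at hS'
  push_cast at hS hS'
  have hG := geom_sum_mul (z ^ 2) (n + 1)
  rw [hpow] at hG
  have h0 := profile_one_algebra hz hy hz1 hu hv hG
  have h1 := profileDeriv_one_algebra hz hy hz1 hu hv hu' hS hS'
  rw [hStar_eq_sum, hzi, ← hz_def, ← h0, ← h1, profile, profileDeriv, one_mul, ← hu_def, ← hv_def,
    ← hu'_def, ← hsin, ← hcos]
  push_cast
  ring

theorem continuous_profile (n : ℕ) (t : ℝ) : Continuous fun ω => profile n ω t := by
  unfold profile
  fun_prop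

theorem continuous_profileDeriv (n : ℕ) (t : ℝ) : Continuous fun ω => profileDeriv n ω t := by
  unfold profileDeriv
  fun_prop

theorem continuous_hStar (d : ℕ) (θ : ℝ) : Continuous fun ω => hStar d ω θ := by
  unfold hStar
  fun_prop

theorem dense_sin_ne_zero : Dense {ω : ℝ | Real.sin ω ≠ 0} := by
  have h : {ω : ℝ | Real.sin ω ≠ 0} = (Set.range fun n : ℤ => (n : ℝ) * Real.pi)ᶜ := by
    ext ω; simp [Real.sin_eq_zero_iff]
  rw [h]
  exact (Set.countable_range _).dense_compl ℝ

/-- The first-order Taylor polynomial of `profile` at `t = 1` is `hStar`; by continuity in `ω` the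
zeros of `sin ω` need no separate computation. -/
theorem taylor_profile_eq_hStar (n : ℕ) (ω θ : ℝ) :
    profile n ω 1 - ((1 - Real.cos θ : ℝ) : ℂ) * profileDeriv n ω 1 = hStar (n + 1) ω θ :=
  congrFun (Continuous.ext_on dense_sin_ne_zero
    ((continuous_profile n 1).sub (continuous_const.mul (continuous_profileDeriv n 1)))
    (continuous_hStar (n + 1) θ)
    fun _ hω => taylor_profile_eq_hStar_of_sin_ne_zero n θ hω) ω

/-! ### Fourier coefficients -/

theorem integral_exp_two_I_mul_int (m : ℤ) :
    ∫ ω in (0 : ℝ)..Real.pi, Complex.exp (2 * Complex.I * m * ω) =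
      if m = 0 then (Real.pi : ℂ) else 0 := by
  split_ifs with hm
  · simp [hm]
  · have hc : 2 * Complex.I * (m : ℂ) ≠ 0 := by simp [hm]
    rw [integral_exp_mul_complex hc]
    have : Complex.exp (2 * Complex.I * m * (Real.pi : ℝ)) = 1 := by
      rw [← Complex.exp_int_mul_two_pi_mul_I m]; ring_nf
    simp [this]

/-- By orthogonality of the exponentials, `sin θ * cStar d k θ` is the `k`-th Fourier coefficient of
`sin θ * e^{-iω} * hStar d ω θ`. -/
theorem fourierCoeff_hStar (d : ℕ) (θ : ℝ) {k : ℤ}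
    (hk : k ∈ Set.Icc (-(d : ℤ) + 1) ((d : ℤ) - 1)) :
    (1 / (Real.pi : ℂ)) * ∫ ω in (0 : ℝ)..Real.pi, Complex.exp (-(2 * Complex.I * k * ω)) *
      ((Real.sin θ : ℂ) * Complex.exp (-(Complex.I * ω)) * hStar d ω θ)
      = (Real.sin θ : ℂ) * (cStar d k θ : ℂ) := by
  have hpi : (Real.pi : ℂ) ≠ 0 := Complex.ofReal_ne_zero.2 Real.pi_ne_zero
  have hint : ∀ ω : ℝ, Complex.exp (-(2 * Complex.I * k * ω)) *
      ((Real.sin θ : ℂ) * Complex.exp (-(Complex.I * ω)) * hStar d ω θ)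
      = ∑ j ∈ Finset.Icc (-(d : ℤ) + 1) ((d : ℤ) - 1), (Real.sin θ : ℂ) * (cStar d j θ : ℂ) *
        Complex.exp (2 * Complex.I * ((j - k : ℤ) : ℂ) * ω) := fun ω => by
    rw [hStar, Finset.mul_sum, Finset.mul_sum]
    refine Finset.sum_congr rfl fun j _ => ?_
    rw [show 2 * Complex.I * ((j - k : ℤ) : ℂ) * ω = -(2 * Complex.I * k * ω)
      + -(Complex.I * ω) + Complex.I * (2 * j + 1) * ω by push_cast; ring, Complex.exp_add,
      Complex.exp_add]
    ring
  simp_rw [hint]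
  rw [intervalIntegral.integral_finsetSum
    fun j _ => Continuous.intervalIntegrable (by fun_prop) _ _]
  simp_rw [intervalIntegral.integral_const_mul, integral_exp_two_I_mul_int, sub_eq_zero]
  rw [Finset.sum_eq_single_of_mem k (Finset.mem_Icc.2 hk) fun j _ hj => by simp [hj], if_pos rfl]
  field_simp

theorem mainTheorem3 (d : ℕ) (hd : 0 < d) (θ φ χ : ℝ) :
    (Real.sin θ ≠ 0 → ∀ ω ∈ Set.Icc (0 : ℝ) Real.pi,
      ‖hHat d ω θ φ χ - hStar d ω θ‖ ≤ 2 * (d : ℝ) ^ 5 * θ ^ 4) ∧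
    (∀ k ∈ Set.Icc (-(d : ℤ) + 1) ((d : ℤ) - 1),
      ‖cTilde d k θ φ χ - (Real.sin θ : ℂ) * (cStar d k θ : ℂ)‖ ≤ 2 * ((d : ℝ) * |θ|) ^ 5) := by
  obtain ⟨n, rfl⟩ := Nat.exists_eq_add_of_lt hd
  rw [zero_add]
  have hbound : ∀ ω : ℝ, ‖profile n ω (Real.cos θ) - hStar (n + 1) ω θ‖
      ≤ 2 * ((n + 1 : ℕ) : ℝ) ^ 5 * θ ^ 4 := fun ω => by
    have h := norm_profile_sub_taylor_le n ω θ
    rw [taylor_profile_eq_hStar] at h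
    exact_mod_cast h
  refine ⟨fun hsin ω _ => ?_, fun k hk => ?_⟩
  · have hne : (Real.sin θ : ℂ) * Complex.exp (-(Complex.I * ω)) ≠ 0 :=
      mul_ne_zero (Complex.ofReal_ne_zero.2 hsin) (Complex.exp_ne_zero _)
    rw [hHat, hTilde_eq, mul_div_cancel_left₀ _ hne]
    exact hbound ω
  · have hprofile := continuous_profile n (Real.cos θ)
    have hstar := continuous_hStar (n + 1) θ
    have hexp : ∀ x : ℝ, ‖Complex.exp (-(Complex.I * x))‖ = 1 := fun x => by
      simpa [mul_comm] using Complex.norm_exp_ofReal_mul_I (-x)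
    rw [← fourierCoeff_hStar (n + 1) θ hk, cTilde, ← mul_sub]
    simp_rw [hTilde_eq]
    rw [← intervalIntegral.integral_sub (Continuous.intervalIntegrable (by fun_prop) _ _)
      (Continuous.intervalIntegrable (by fun_prop) _ _)]
    have hle := intervalIntegral.norm_integral_le_of_norm_le_const (a := 0) (b := Real.pi)
      (C := |θ| * (2 * ((n + 1 : ℕ) : ℝ) ^ 5 * θ ^ 4))
      (f := fun ω : ℝ => Complex.exp (-(2 * Complex.I * k * ω)) *
          ((Real.sin θ : ℂ) * Complex.exp (-(Complex.I * ω)) * profile n ω (Real.cos θ))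
        - Complex.exp (-(2 * Complex.I * k * ω)) *
          ((Real.sin θ : ℂ) * Complex.exp (-(Complex.I * ω)) * hStar (n + 1) ω θ))
      fun ω _ => by
        have hk1 : ‖Complex.exp (-(2 * Complex.I * k * ω))‖ = 1 := by
          rw [← hexp (2 * k * ω)]; push_cast; ring_nf
        rw [← mul_sub, ← mul_sub, norm_mul, norm_mul, norm_mul, hk1, hexp, one_mul, mul_one,
          Complex.norm_real, Real.norm_eq_abs]
        exact mul_le_mul Real.abs_sin_le_abs (hbound ω) (norm_nonneg _) (abs_nonneg _)
    rw [sub_zero, abs_of_pos Real.pi_pos] at hle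
    rw [norm_mul, norm_div, norm_one, Complex.norm_real, Real.norm_of_nonneg Real.pi_pos.le,
      one_div, inv_mul_le_iff₀ Real.pi_pos]
    refine hle.trans_eq ?_
    -- The factor `|sin θ| ≤ |θ|` raises `θ ^ 4` to `|θ| ^ 5`.
    rw [← (show Even 4 by decide).pow_abs θ]
    ring
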